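/- Let $\mathbb H_2$ be the Siegel upper half-space of symmetric complex $2\times2$ matrices with positive definite imaginary part, on which $\Gamma_2=\mathrm{Sp}_4(\mathbb Z)$ acts by $\gamma\Omega=(A\Omega+B)(C\Omega+D)^{-1}$, $\gamma=\begin{pmatrix}A&B\\C&D\end{pmatrix}$. For $k=b_0+2b_1+4a_0+8a_1\in\{0,\dots,15\}$ with $a=(a_0,a_1),\,b=(b_0,b_1)\in\{0,1\}^2$, let $$\theta_k(\Omega)=\sum_{n\in\mathbb Z^2}\exp\bigl(i\pi\,{}^t(n+\tfrac a2)\Omega(n+\tfrac a2)+2i\pi\,{}^t(n+\tfrac a2)\tfrac b2\bigr).$$ Let $\Gamma(2,4)$ be the group of $\gamma\in\Gamma_2$ with $\gamma\equiv I_4\bmod 2$ such that the diagonals of $B$ and $C$ are $\equiv0\bmod4$. Let $p>2$ be a prime, let $\Gamma_0(p)$ be the group of $\gamma\in\Gamma_2$ with $C\equiv0\bmod p$, and for $\gamma\in\Gamma_0(p)$ put $\gamma_p=\begin{pmatrix}A&pB\\C/p&D\end{pmatrix}\in\Gamma_2$. Let $\mathcal L_p'\subseteq\Gamma(2,4)\backslash\mathbb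 H_2$ be the locus of the classes of those $\Omega$ for which there is $M\in\Gamma(2,4)$ with $\theta_0(pM\Omega/2)=0$. Let $\gamma\in\Gamma_2$, let $\gamma_0\in\Gamma_0(p)$ be a representative of the class of $\gamma$ in $\Gamma_2/\Gamma(2,4)$, and let $\gamma'\in\Gamma_2$ be such that $(\gamma_0)_p$ and $\gamma'$ have the same class in $\Gamma_2/\Gamma(2,4)$. Suppose that the action of $\gamma'$ on the squares of the theta constants sends $\{\theta_0^2,\theta_4^2,\theta_8^2,\theta_{12}^2\}$ to itself up to a common factor; that is, there are a permutation $\sigma$ of $\{0,4,8,12\}$ and a constant $c\in\mathbb C$ such that, with $C',D'$ the lower blocks of $\gamma'$, $$\theta_k(\gamma'\Omega)^2=c\,\det(C'\Omega+D')\,\theta_{\sigma(k)}(\Omega)^2\qquad\text{for all }k\in\{0,4,8,12\}\text{ and all }\Omega\in\mathbb H_2.$$ Then, for every $\Omega\in\mathbb H_2$ whose class lies in $\mathcal L_p'$, the class of $\gamma\Omega$ lies in $\mathcal L_p'$. -/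

import Mathlib

open Matrix
open scoped ComplexOrder

noncomputable section

/-! ### The Siegel upper half-space and the action of the symplectic group -/

/-- The Siegel upper half-space: symmetric complex `g × g` matrices with positive definite
imaginary part. -/
def SiegelSpace (g : ℕ) : Type :=
  {Ω : Matrix (Fin g) (Fin g) ℂ // Ω.IsSymm ∧ (Ω.map Complex.im).PosDef}

/-- `Γ_g = Sp_{2g}(ℤ)`, written in `g × g` blocks. -/
abbrev SiegelGroup (g : ℕ) : Type := symplecticGroup (Fin g) ℤ

namespace SiegelGroup

variable {g : ℕ}

def A (γ : SiegelGroup g) : Matrix (Fin g) (Fin g) ℤ := γ.1.toBlocks₁₁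
def B (γ : SiegelGroup g) : Matrix (Fin g) (Fin g) ℤ := γ.1.toBlocks₁₂
def C (γ : SiegelGroup g) : Matrix (Fin g) (Fin g) ℤ := γ.1.toBlocks₂₁
def D (γ : SiegelGroup g) : Matrix (Fin g) (Fin g) ℤ := γ.1.toBlocks₂₂

theorem coe_eq (γ : SiegelGroup g) : γ.1 = fromBlocks γ.A γ.B γ.C γ.D :=
  (fromBlocks_toBlocks γ.1).symm

theorem rel (γ : SiegelGroup g) :
    γ.Aᵀ * γ.C = γ.Cᵀ * γ.A ∧ γ.Bᵀ * γ.D = γ.Dᵀ * γ.B ∧ γ.Aᵀ * γ.D - γ.Cᵀ * γ.B = 1 :=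
  SymplecticGroup.fromBlocks_mem_iff.1 (coe_eq γ ▸ γ.2)

theorem mul_blocks (γ δ : SiegelGroup g) :
    (γ * δ).A = γ.A * δ.A + γ.B * δ.C ∧ (γ * δ).B = γ.A * δ.B + γ.B * δ.D ∧
      (γ * δ).C = γ.C * δ.A + γ.D * δ.C ∧ (γ * δ).D = γ.C * δ.B + γ.D * δ.D := by
  have h : (γ * δ).1 = fromBlocks γ.A γ.B γ.C γ.D * fromBlocks δ.A δ.B δ.C δ.D := by
    rw [← coe_eq, ← coe_eq]; rfl
  rw [coe_eq (γ * δ), fromBlocks_multiply] at h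
  exact fromBlocks_inj.1 h

theorem one_blocks : (1 : SiegelGroup g).A = 1 ∧ (1 : SiegelGroup g).B = 0 ∧
    (1 : SiegelGroup g).C = 0 ∧ (1 : SiegelGroup g).D = 1 := by
  have h : (1 : SiegelGroup g).1 = fromBlocks 1 0 0 1 := fromBlocks_one.symm
  rw [coe_eq 1] at h
  exact fromBlocks_inj.1 h

theorem inv_blocks (γ : SiegelGroup g) :
    (γ⁻¹).A = γ.Dᵀ ∧ (γ⁻¹).B = -γ.Bᵀ ∧ (γ⁻¹).C = -γ.Cᵀ ∧ (γ⁻¹).D = γ.Aᵀ := by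
  have h : (γ⁻¹).1 = fromBlocks γ.Dᵀ (-γ.Bᵀ) (-γ.Cᵀ) γ.Aᵀ := by
    rw [SymplecticGroup.coe_inv, coe_eq γ, J, fromBlocks_transpose, fromBlocks_neg,
      fromBlocks_multiply, fromBlocks_multiply]
    simp
  rw [coe_eq γ⁻¹] at h
  exact fromBlocks_inj.1 h

/-- An integral matrix viewed as a complex one. -/
abbrev toC (M : Matrix (Fin g) (Fin g) ℤ) : Matrix (Fin g) (Fin g) ℂ := M.map (Int.cast : ℤ → ℂ)

theorem toC_mul (M N : Matrix (Fin g) (Fin g) ℤ) : toC (M * N) = toC M * toC N :=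
  Matrix.map_mul (f := Int.castRingHom ℂ)

theorem toC_add (M N : Matrix (Fin g) (Fin g) ℤ) : toC (M + N) = toC M + toC N := by
  ext i j; simp

theorem toC_sub (M N : Matrix (Fin g) (Fin g) ℤ) : toC (M - N) = toC M - toC N := by
  ext i j; simp

theorem toC_one : toC (1 : Matrix (Fin g) (Fin g) ℤ) = 1 :=
  Matrix.map_one _ Int.cast_zero Int.cast_one

theorem toC_conjTranspose (M : Matrix (Fin g) (Fin g) ℤ) : (toC M)ᴴ = toC Mᵀ := by
  ext i j; simp [conjTranspose_apply]

/-- `AΩ + B`. -/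
def num (γ : SiegelGroup g) (Ω : Matrix (Fin g) (Fin g) ℂ) : Matrix (Fin g) (Fin g) ℂ :=
  toC γ.A * Ω + toC γ.B

/-- `CΩ + D`. -/
def denom (γ : SiegelGroup g) (Ω : Matrix (Fin g) (Fin g) ℂ) : Matrix (Fin g) (Fin g) ℂ :=
  toC γ.C * Ω + toC γ.D

theorem relC (γ : SiegelGroup g) :
    (toC γ.A)ᵀ * toC γ.C = (toC γ.C)ᵀ * toC γ.A ∧ (toC γ.B)ᵀ * toC γ.D = (toC γ.D)ᵀ * toC γ.B ∧
      (toC γ.A)ᵀ * toC γ.D - (toC γ.C)ᵀ * toC γ.B = 1 := by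
  obtain ⟨h1, h2, h3⟩ := γ.rel
  refine ⟨?_, ?_, ?_⟩
  · simpa only [toC_mul, transpose_map] using congrArg toC h1
  · simpa only [toC_mul, transpose_map] using congrArg toC h2
  · simpa only [toC_mul, toC_sub, toC_one, transpose_map] using congrArg toC h3

theorem relC' (γ : SiegelGroup g) :
    (toC γ.D)ᵀ * toC γ.A - (toC γ.B)ᵀ * toC γ.C = 1 := by
  simpa [transpose_sub, transpose_mul] using congrArg transpose γ.relC.2.2

theorem num_transpose_mul_denom (γ : SiegelGroup g) {Ω : Matrix (Fin g) (Fin g) ℂ}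
    (h : Ω.IsSymm) : (γ.num Ω)ᵀ * γ.denom Ω = (γ.denom Ω)ᵀ * γ.num Ω := by
  obtain ⟨h1, h2, h3⟩ := γ.relC
  have h4 := γ.relC'
  have e : (γ.num Ω)ᵀ * γ.denom Ω - (γ.denom Ω)ᵀ * γ.num Ω =
      Ω * ((toC γ.A)ᵀ * toC γ.C - (toC γ.C)ᵀ * toC γ.A) * Ω
      + Ω * ((toC γ.A)ᵀ * toC γ.D - (toC γ.C)ᵀ * toC γ.B)
      - ((toC γ.D)ᵀ * toC γ.A - (toC γ.B)ᵀ * toC γ.C) * Ω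
      + ((toC γ.B)ᵀ * toC γ.D - (toC γ.D)ᵀ * toC γ.B) := by
    simp only [num, denom, transpose_add, transpose_mul, h.eq]
    noncomm_ring
  rw [h1, h2, h3, h4] at e
  rw [← sub_eq_zero, e]
  simp

theorem denom_conjTranspose_mul_num (γ : SiegelGroup g) (Ω : Matrix (Fin g) (Fin g) ℂ) :
    (γ.denom Ω)ᴴ * γ.num Ω - (γ.num Ω)ᴴ * γ.denom Ω = Ω - Ωᴴ := by
  obtain ⟨h1, h2, h3⟩ := γ.relC
  have h4 := γ.relC'
  have e : (γ.denom Ω)ᴴ * γ.num Ω - (γ.num Ω)ᴴ * γ.denom Ω =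
      Ωᴴ * ((toC γ.C)ᵀ * toC γ.A - (toC γ.A)ᵀ * toC γ.C) * Ω
      - Ωᴴ * ((toC γ.A)ᵀ * toC γ.D - (toC γ.C)ᵀ * toC γ.B)
      + ((toC γ.D)ᵀ * toC γ.A - (toC γ.B)ᵀ * toC γ.C) * Ω
      + ((toC γ.D)ᵀ * toC γ.B - (toC γ.B)ᵀ * toC γ.D) := by
    simp only [num, denom, conjTranspose_add, conjTranspose_mul, toC_conjTranspose,
      transpose_map]
    noncomm_ring
  rw [h1, h2, h3, h4] at e
  rw [e]
  simp only [sub_self, mul_zero, zero_mul, mul_one, one_mul, add_zero, zero_sub]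
  abel

theorem sub_conjTranspose_eq {Ω : Matrix (Fin g) (Fin g) ℂ} (h : Ω.IsSymm) :
    Ω - Ωᴴ = (2 * Complex.I) • (Ω.map Complex.im).map (Complex.ofReal) := by
  ext i j
  have hs : Ω j i = Ω i j := h.apply i j
  simp only [Matrix.sub_apply, conjTranspose_apply, hs, Matrix.smul_apply, Matrix.map_apply,
    smul_eq_mul]
  apply Complex.ext
  · simp
  · simp; ring

theorem posDef_ofReal {Y : Matrix (Fin g) (Fin g) ℝ} (hY : Y.PosDef) :
    (Y.map (Complex.ofReal)).PosDef := by
  have hs : ∀ i j, Y i j = Y j i := fun i j => by simpa using hY.isHermitian.apply j i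
  refine PosDef.of_dotProduct_mulVec_pos ?_ fun x hx => ?_
  · ext i j; simp [conjTranspose_apply, hs i j]
  · have hre : (star x ⬝ᵥ (Y.map (Complex.ofReal) *ᵥ x)) =
        (((fun i => (x i).re) ⬝ᵥ (Y *ᵥ fun i => (x i).re) +
          (fun i => (x i).im) ⬝ᵥ (Y *ᵥ fun i => (x i).im) : ℝ) : ℂ) := by
      have key : ∑ i, ∑ j, Y i j * ((x i).re * (x j).im - (x i).im * (x j).re) = 0 := by
        have : ∑ i, ∑ j, Y i j * ((x i).re * (x j).im - (x i).im * (x j).re) =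
            -∑ i, ∑ j, Y i j * ((x i).re * (x j).im - (x i).im * (x j).re) := by
          conv_lhs => rw [Finset.sum_comm]
          rw [← Finset.sum_neg_distrib]
          refine Finset.sum_congr rfl fun i _ => ?_
          rw [← Finset.sum_neg_distrib]
          refine Finset.sum_congr rfl fun j _ => ?_
          rw [hs j i]; ring
        linarith
      simp only [dotProduct, mulVec, Finset.mul_sum, Matrix.map_apply, Pi.star_apply]
      apply Complex.ext
      · simp only [Complex.re_sum, Complex.ofReal_re, ← Finset.sum_add_distrib]
        refine Finset.sum_congr rfl fun i _ => Finset.sum_congr rfl fun j _ => ?_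
        simp
      · simp only [Complex.im_sum, Complex.ofReal_im]
        rw [← key]
        refine Finset.sum_congr rfl fun i _ => Finset.sum_congr rfl fun j _ => ?_
        simp
        ring
    rw [hre]
    have nn : ∀ u : Fin g → ℝ, 0 ≤ u ⬝ᵥ (Y *ᵥ u) := fun u => by
      simpa using hY.posSemidef.dotProduct_mulVec_nonneg u
    have pp : ∀ u : Fin g → ℝ, u ≠ 0 → 0 < u ⬝ᵥ (Y *ᵥ u) := fun u hu => by
      simpa using hY.dotProduct_mulVec_pos hu
    have : 0 < (fun i => (x i).re) ⬝ᵥ (Y *ᵥ fun i => (x i).re) +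
          (fun i => (x i).im) ⬝ᵥ (Y *ᵥ fun i => (x i).im) := by
      by_cases h0 : (fun i => (x i).re) = 0
      · have h1 : (fun i => (x i).im) ≠ 0 := fun h1 => hx <| funext fun i =>
          Complex.ext (congrFun h0 i) (congrFun h1 i)
        exact add_pos_of_nonneg_of_pos (nn _) (pp _ h1)
      · exact add_pos_of_pos_of_nonneg (pp _ h0) (nn _)
    exact_mod_cast this

theorem posDef_of_ofReal {Y : Matrix (Fin g) (Fin g) ℝ}
    (hY : (Y.map (Complex.ofReal)).PosDef) : Y.PosDef := by
  refine PosDef.of_dotProduct_mulVec_pos ?_ fun x hx => ?_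
  · ext i j
    have := hY.isHermitian.apply i j
    simp only [Matrix.map_apply, Complex.star_def, Complex.conj_ofReal] at this
    simpa [conjTranspose_apply] using Complex.ofReal_injective this
  · have hx' : (fun i => (x i : ℂ)) ≠ 0 := fun h => hx <| funext fun i => by
      simpa using congrFun h i
    have h := hY.dotProduct_mulVec_pos hx'
    have e : (star (fun i => (x i : ℂ)) ⬝ᵥ (Y.map (Complex.ofReal) *ᵥ fun i => (x i : ℂ))) =
        ((star x ⬝ᵥ (Y *ᵥ x) : ℝ) : ℂ) := by
      simp [dotProduct, mulVec]
    rw [e] at h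
    exact_mod_cast h

theorem isUnit_denom (γ : SiegelGroup g) (Ω : SiegelSpace g) : IsUnit (γ.denom Ω.1) := by
  have hY := posDef_ofReal Ω.2.2
  rw [← mulVec_injective_iff_isUnit, ← coe_mulVecLin, ← LinearMap.ker_eq_bot,
    ker_mulVecLin_eq_bot_iff]
  intro x hx
  by_contra hne
  have h := congrArg (fun M => star x ⬝ᵥ (M *ᵥ x)) (γ.denom_conjTranspose_mul_num Ω.1)
  simp only [sub_conjTranspose_eq Ω.2.1, sub_mulVec, ← mulVec_mulVec, hx, mulVec_zero, sub_zero,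
    smul_mulVec, dotProduct_smul] at h
  rw [dotProduct_mulVec, ← star_mulVec, hx, star_zero, zero_dotProduct, eq_comm,
    smul_eq_mul] at h
  have := hY.dotProduct_mulVec_pos hne
  have h0 := (mul_eq_zero.1 h).resolve_left (by simp)
  exact this.ne' h0

/-- `γΩ = (AΩ + B)(CΩ + D)⁻¹`. -/
def act (γ : SiegelGroup g) (Ω : SiegelSpace g) : SiegelSpace g :=
  ⟨γ.num Ω.1 * (γ.denom Ω.1)⁻¹, by
    have hu := (isUnit_iff_isUnit_det _).1 (γ.isUnit_denom Ω)
    set U := γ.num Ω.1 with hU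
    set V := γ.denom Ω.1 with hV
    have hs : (U * V⁻¹).IsSymm := by
      have h := γ.num_transpose_mul_denom Ω.2.1
      rw [← hU, ← hV] at h
      have hut : IsUnit (Vᵀ).det := by rwa [det_transpose]
      have hsym : (V⁻¹)ᵀ * Uᵀ = U * V⁻¹ := by
        calc (V⁻¹)ᵀ * Uᵀ = (Vᵀ)⁻¹ * (Uᵀ * V) * V⁻¹ := by
              rw [transpose_nonsing_inv, ← Matrix.mul_assoc, Matrix.mul_assoc _ V,
                mul_nonsing_inv _ hu, Matrix.mul_one]
          _ = U * V⁻¹ := by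
              rw [h, ← Matrix.mul_assoc, nonsing_inv_mul _ hut, Matrix.one_mul]
      rw [Matrix.IsSymm, transpose_mul, hsym]
    refine ⟨hs, posDef_of_ofReal ?_⟩
    have hI : (2 * Complex.I) ≠ 0 := by simp
    have e : ((U * V⁻¹).map Complex.im).map (Complex.ofReal) =
        (V⁻¹)ᴴ * (Ω.1.map Complex.im).map (Complex.ofReal) * V⁻¹ := by
      refine smul_right_injective _ hI ?_
      simp only
      rw [← sub_conjTranspose_eq hs, ← Matrix.smul_mul, ← Matrix.mul_smul,
        ← sub_conjTranspose_eq Ω.2.1, ← γ.denom_conjTranspose_mul_num Ω.1, ← hU, ← hV,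
        Matrix.mul_sub, Matrix.sub_mul, conjTranspose_mul]
      have h1 : (V⁻¹)ᴴ * Vᴴ = 1 := by
        rw [← conjTranspose_mul, mul_nonsing_inv _ hu, conjTranspose_one]
      rw [← Matrix.mul_assoc, h1, Matrix.one_mul, Matrix.mul_assoc, Matrix.mul_assoc,
        mul_nonsing_inv _ hu, Matrix.mul_one]
    rw [e]
    refine (posDef_ofReal Ω.2.2).conjTranspose_mul_mul_same ?_
    exact mulVec_injective_iff_isUnit.2 ((isUnit_iff_isUnit_det _).2 (isUnit_nonsing_inv_det _ hu))⟩

theorem denom_mul (γ δ : SiegelGroup g) (Ω : SiegelSpace g) :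
    (γ * δ).denom Ω.1 = γ.denom (δ.act Ω).1 * δ.denom Ω.1 := by
  have hu := (isUnit_iff_isUnit_det _).1 (δ.isUnit_denom Ω)
  obtain ⟨_, _, h3, h4⟩ := mul_blocks γ δ
  have e : γ.denom (δ.act Ω).1 * δ.denom Ω.1 = toC γ.C * δ.num Ω.1 + toC γ.D * δ.denom Ω.1 := by
    change (toC γ.C * (δ.num Ω.1 * (δ.denom Ω.1)⁻¹) + toC γ.D) * δ.denom Ω.1 = _
    rw [Matrix.add_mul, Matrix.mul_assoc, Matrix.mul_assoc, nonsing_inv_mul _ hu, Matrix.mul_one]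
  rw [e]
  simp only [denom, num, h3, h4, toC_mul, toC_add]
  noncomm_ring

theorem num_mul (γ δ : SiegelGroup g) (Ω : SiegelSpace g) :
    (γ * δ).num Ω.1 = γ.num (δ.act Ω).1 * δ.denom Ω.1 := by
  have hu := (isUnit_iff_isUnit_det _).1 (δ.isUnit_denom Ω)
  obtain ⟨h1, h2, _, _⟩ := mul_blocks γ δ
  have e : γ.num (δ.act Ω).1 * δ.denom Ω.1 = toC γ.A * δ.num Ω.1 + toC γ.B * δ.denom Ω.1 := by
    change (toC γ.A * (δ.num Ω.1 * (δ.denom Ω.1)⁻¹) + toC γ.B) * δ.denom Ω.1 = _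
    rw [Matrix.add_mul, Matrix.mul_assoc, Matrix.mul_assoc, nonsing_inv_mul _ hu, Matrix.mul_one]
  rw [e]
  simp only [denom, num, h1, h2, toC_mul, toC_add]
  noncomm_ring

instance : MulAction (SiegelGroup g) (SiegelSpace g) where
  smul := act
  one_smul Ω := by
    obtain ⟨h1, h2, h3, h4⟩ := one_blocks (g := g)
    refine Subtype.ext ?_
    change num 1 Ω.1 * (denom 1 Ω.1)⁻¹ = Ω.1
    simp [num, denom, h1, h2, h3, h4]
  mul_smul γ δ Ω := by
    refine Subtype.ext ?_
    change (γ * δ).num Ω.1 * ((γ * δ).denom Ω.1)⁻¹ =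
      γ.num (δ.act Ω).1 * (γ.denom (δ.act Ω).1)⁻¹
    have hu := (isUnit_iff_isUnit_det _).1 (δ.isUnit_denom Ω)
    rw [num_mul, denom_mul, Matrix.mul_inv_rev, Matrix.mul_assoc,
      ← Matrix.mul_assoc (δ.denom Ω.1), mul_nonsing_inv _ hu, Matrix.one_mul]

theorem smul_coe (γ : SiegelGroup g) (Ω : SiegelSpace g) :
    (γ • Ω).1 = γ.num Ω.1 * (γ.denom Ω.1)⁻¹ := rfl

end SiegelGroup

/-- `rΩ` for a real number `r > 0`. -/
def SiegelSpace.scale {g : ℕ} (r : ℝ) (hr : 0 < r) (Ω : SiegelSpace g) : SiegelSpace g :=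
  ⟨(r : ℂ) • Ω.1, by
    refine ⟨by rw [Matrix.IsSymm, transpose_smul, Ω.2.1.eq], ?_⟩
    have e : ((r : ℂ) • Ω.1).map Complex.im = r • Ω.1.map Complex.im := by
      ext i j; simp
    rw [e]
    exact Ω.2.2.smul hr⟩

/-! ### Congruence subgroups -/

namespace SiegelGroup

variable {g : ℕ}

/-- `Γ_0(p)`: the symplectic matrices with `C ≡ 0 mod p`. -/
def Gamma0 (g p : ℕ) : Subgroup (SiegelGroup g) where
  carrier := {γ | ∀ i j, (p : ℤ) ∣ γ.C i j}
  mul_mem' {γ δ} hγ hδ i j := by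
    rw [(mul_blocks γ δ).2.2.1, Matrix.add_apply, Matrix.mul_apply, Matrix.mul_apply]
    exact dvd_add (Finset.dvd_sum fun k _ => (hγ i k).mul_right _)
      (Finset.dvd_sum fun k _ => (hδ k j).mul_left _)
  one_mem' i j := by
    rw [one_blocks.2.2.1]; simp
  inv_mem' {γ} hγ i j := by
    rw [(inv_blocks γ).2.2.1]; simpa using hγ j i

theorem diag_mul_mod_four {X Y : Matrix (Fin g) (Fin g) ℤ}
    (hX : ∀ i j, (2 : ℤ) ∣ (X - 1) i j) (hY : ∀ i j, (2 : ℤ) ∣ Y i j) (i : Fin g)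
    (hi : (4 : ℤ) ∣ Y i i) : (4 : ℤ) ∣ (X * Y) i i ∧ (4 : ℤ) ∣ (Y * X) i i := by
  have e1 : X * Y = (X - 1) * Y + Y := by noncomm_ring
  have e2 : Y * X = Y * (X - 1) + Y := by noncomm_ring
  rw [e1, e2, Matrix.add_apply, Matrix.add_apply, Matrix.mul_apply, Matrix.mul_apply]
  have h4 : (4 : ℤ) = 2 * 2 := by norm_num
  refine ⟨dvd_add (Finset.dvd_sum fun k _ => ?_) hi, dvd_add (Finset.dvd_sum fun k _ => ?_) hi⟩
  · rw [h4]; exact mul_dvd_mul (hX i k) (hY k i)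
  · rw [h4]; exact mul_dvd_mul (hY i k) (hX k i)

theorem even_sub_one_mul {X Y : Matrix (Fin g) (Fin g) ℤ}
    (hX : ∀ i j, (2 : ℤ) ∣ (X - 1) i j) (hY : ∀ i j, (2 : ℤ) ∣ (Y - 1) i j) (i j : Fin g) :
    (2 : ℤ) ∣ (X * Y - 1) i j := by
  have e : X * Y - 1 = (X - 1) * Y + (Y - 1) := by noncomm_ring
  rw [e, Matrix.add_apply, Matrix.mul_apply]
  exact dvd_add (Finset.dvd_sum fun k _ => (hX i k).mul_right _) (hY i j)

theorem even_mul_left {X Y : Matrix (Fin g) (Fin g) ℤ}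
    (hY : ∀ i j, (2 : ℤ) ∣ Y i j) (i j : Fin g) : (2 : ℤ) ∣ (X * Y) i j := by
  rw [Matrix.mul_apply]; exact Finset.dvd_sum fun k _ => (hY k j).mul_left _

theorem even_mul_right {X Y : Matrix (Fin g) (Fin g) ℤ}
    (hX : ∀ i j, (2 : ℤ) ∣ X i j) (i j : Fin g) : (2 : ℤ) ∣ (X * Y) i j := by
  rw [Matrix.mul_apply]; exact Finset.dvd_sum fun k _ => (hX i k).mul_right _

/-- `Γ(2,4)`: the symplectic matrices congruent to the identity mod `2` such that the diagonals
of `B` and `C` vanish mod `4`. -/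
def Gamma24 (g : ℕ) : Subgroup (SiegelGroup g) where
  carrier := {γ | (∀ i j, (2 : ℤ) ∣ (γ.A - 1) i j) ∧ (∀ i j, (2 : ℤ) ∣ γ.B i j) ∧
    (∀ i j, (2 : ℤ) ∣ γ.C i j) ∧ (∀ i j, (2 : ℤ) ∣ (γ.D - 1) i j) ∧
    (∀ i, (4 : ℤ) ∣ γ.B i i) ∧ (∀ i, (4 : ℤ) ∣ γ.C i i)}
  mul_mem' {γ δ} := by
    rintro ⟨a1, b1, c1, d1, e1, f1⟩ ⟨a2, b2, c2, d2, e2, f2⟩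
    obtain ⟨hA, hB, hC, hD⟩ := mul_blocks γ δ
    refine ⟨fun i j => ?_, fun i j => ?_, fun i j => ?_, fun i j => ?_, fun i => ?_, fun i => ?_⟩
    · rw [hA, add_sub_right_comm, Matrix.add_apply]
      exact dvd_add (even_sub_one_mul a1 a2 i j) (even_mul_left c2 i j)
    · rw [hB, Matrix.add_apply]
      exact dvd_add (even_mul_left b2 i j) (even_mul_right b1 i j)
    · rw [hC, Matrix.add_apply]
      exact dvd_add (even_mul_right c1 i j) (even_mul_left c2 i j)
    · rw [hD, add_sub_assoc, Matrix.add_apply]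
      exact dvd_add (even_mul_left b2 i j) (even_sub_one_mul d1 d2 i j)
    · rw [hB, Matrix.add_apply]
      exact dvd_add (diag_mul_mod_four a1 b2 i (e2 i)).1 (diag_mul_mod_four d2 b1 i (e1 i)).2
    · rw [hC, Matrix.add_apply]
      exact dvd_add (diag_mul_mod_four a2 c1 i (f1 i)).2 (diag_mul_mod_four d1 c2 i (f2 i)).1
  one_mem' := by
    obtain ⟨h1, h2, h3, h4⟩ := one_blocks (g := g)
    simp [h1, h2, h3, h4]
  inv_mem' {γ} := by
    rintro ⟨a, b, c, d, e, f⟩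
    obtain ⟨h1, h2, h3, h4⟩ := inv_blocks γ
    refine ⟨fun i j => ?_, fun i j => ?_, fun i j => ?_, fun i j => ?_, fun i => ?_, fun i => ?_⟩
    · rw [h1, ← transpose_one, ← transpose_sub, transpose_apply]; exact d j i
    · rw [h2]; simpa using b j i
    · rw [h3]; simpa using c j i
    · rw [h4, ← transpose_one, ← transpose_sub, transpose_apply]; exact a j i
    · rw [h2]; simpa using e i
    · rw [h3]; simpa using f i

/-- For `γ ∈ Γ_0(p)` with blocks `A, B, C, D`, the symplectic matrix `γ_p` with blocks
`A, pB, C/p, D`; it satisfies `p(γΩ) = γ_p(pΩ)`. -/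
def conjP (p : ℕ) (hp : p ≠ 0) (γ : Gamma0 g p) : SiegelGroup g :=
  ⟨fromBlocks γ.1.A ((p : ℤ) • γ.1.B) (γ.1.C.map (· / (p : ℤ))) γ.1.D, by
    have hp' : (p : ℤ) ≠ 0 := by exact_mod_cast hp
    have hC : γ.1.C = (p : ℤ) • γ.1.C.map (· / (p : ℤ)) := by
      ext i j
      simp only [Matrix.smul_apply, Matrix.map_apply, smul_eq_mul]
      exact (Int.mul_ediv_cancel' (γ.2 i j)).symm
    obtain ⟨h1, h2, h3⟩ := γ.1.rel
    refine SymplecticGroup.fromBlocks_mem_iff.2 ⟨?_, ?_, ?_⟩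
    · refine smul_right_injective _ hp' ?_
      simp only
      rw [← Matrix.mul_smul, ← Matrix.smul_mul, ← transpose_smul, ← hC, h1]
    · rw [transpose_smul, Matrix.smul_mul, Matrix.mul_smul, h2]
    · rw [Matrix.mul_smul, ← Matrix.smul_mul, ← transpose_smul, ← hC, h3]⟩

end SiegelGroup

/-! ### Theta constants of genus two -/

/-- The theta function with characteristic `(a, b)`,
`∑_{n ∈ ℤ^g} exp(iπ ᵗ(n+a) Ω (n+a) + 2iπ ᵗ(n+a)(z+b))`. -/
def thetaFun {g : ℕ} (a b : Fin g → ℚ) (z : Fin g → ℂ) (Ω : SiegelSpace g) : ℂ :=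
  ∑' n : Fin g → ℤ,
    Complex.exp
      (Complex.I * Real.pi *
          ((fun i => (n i : ℂ) + (a i : ℂ)) ⬝ᵥ (Ω.1 *ᵥ fun i => (n i : ℂ) + (a i : ℂ)))
        + 2 * Complex.I * Real.pi *
          ((fun i => (n i : ℂ) + (a i : ℂ)) ⬝ᵥ fun i => z i + (b i : ℂ)))

/-- The theta constant `θ_k`, where `k = b₀ + 2b₁ + 4a₀ + 8a₁` with binary digits
`a = (a₀, a₁)`, `b = (b₀, b₁)` encodes the characteristic `(a/2, b/2)`. -/
def thetaConst (k : Fin 16) (Ω : SiegelSpace 2) : ℂ :=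
  thetaFun ![((k.1 / 4 % 2 : ℕ) : ℚ) / 2, ((k.1 / 8 % 2 : ℕ) : ℚ) / 2]
    ![((k.1 % 2 : ℕ) : ℚ) / 2, ((k.1 / 2 % 2 : ℕ) : ℚ) / 2] 0 Ω

/-- The squared theta constant `θ_k²` is sent by `γ` to `θ_l²` with constant `c`:
`θ_k(γΩ)² = c det(CΩ + D) θ_l(Ω)²` for all `Ω`. By the functional equation of theta functions,
for every even `k` this happens for exactly one `l`, and then `c = ζ_γ² i^ε` with `ζ_γ` an eighth
root of unity depending only on `γ`, and `ε` depending on `γ` and `k`. -/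
def SendsThetaSq (γ : SiegelGroup 2) (c : ℂ) (k l : Fin 16) : Prop :=
  ∀ Ω : SiegelSpace 2,
    thetaConst k (γ • Ω) ^ 2 = c * (γ.denom Ω.1).det * thetaConst l Ω ^ 2

/-- The action of `γ` on the squared theta constants maps the set `{θ_k² : k ∈ S}` bijectively to
itself, up to a factor `c det(CΩ + D)` common to all of `S`. -/
def PreservesThetaSq (γ : SiegelGroup 2) (S : Set (Fin 16)) : Prop :=
  ∃ (c : ℂ) (σ : Fin 16 → Fin 16), Set.BijOn σ S S ∧ ∀ k ∈ S, SendsThetaSq γ c k (σ k)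

/-! ### The locus `L'_p` -/

/-- The moduli space `Γ(2,4)\ℍ₂`. -/
abbrev Moduli24 : Type :=
  MulAction.orbitRel.Quotient (SiegelGroup.Gamma24 2) (SiegelSpace 2)

/-- The class of `Ω` in `Γ(2,4)\ℍ₂`. -/
def Moduli24.mk (Ω : SiegelSpace 2) : Moduli24 := Quotient.mk _ Ω

/-- The locus `L'_p ⊆ Γ(2,4)\ℍ₂`: the classes of those `Ω` for which some `(p,p)`-isogenous
period matrix `pMΩ`, with `M ∈ Γ(2,4)`, satisfies `θ_0(pMΩ/2) = 0`. -/
def locusL' (p : ℕ) (hp : 0 < p) : Set Moduli24 :=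
  {x | ∃ Ω : SiegelSpace 2, Moduli24.mk Ω = x ∧ ∃ M ∈ SiegelGroup.Gamma24 2,
    thetaConst 0 ((M • Ω).scale ((p : ℝ) / 2) (by positivity)) = 0}

end

noncomputable section

/-! ### Theta series of binary quadratic forms -/

/-! Everything takes place on the zero locus `Z` of `θ_0(Ω/2)`. The duplication formula
`halfTheta_sq` writes `θ_0(Ω/2)²` as the sum of `θ_k(Ω)²` over `k = 0, 4, 8, 12`. Since `γ'`
permutes these squares up to a common factor, it maps `Z` into itself.

Suppose `pKΩ ∈ Z` with `K ∈ Γ(2,4)`. Then `γ'(pKΩ) ∈ Z`. As `Γ(2,4)` is normal (`Gamma24_normal`),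
`γ' = δ(γ₀)_p` with `δ ∈ Γ(2,4)`, and `(γ₀)_p(pKΩ) = p(γ₀KΩ)`, so `δ·p(γ₀KΩ) ∈ Z`. It remains to
move `δ` across the multiplication by `p`, which is possible once its upper right block is divisible
by `p` (`exists_smul_scale_eq`). This is arranged by multiplying `δ` on the left by unipotent
matrices with off-diagonal blocks `4S` and `4T` (`exists_unipotent_mul_dvd`). They lie in `Γ(2,4)`
and preserve `Z`: the upper one by periodicity (`halfTheta_upper_smul`), the lower one because the
inversion `Ω ↦ -Ω⁻¹` conjugates it to a translation (`halfTheta_lower_smul_eq_zero_iff`). Hence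
`p(Nγ₀KΩ) ∈ Z` for some `N ∈ Γ(2,4)`, and by normality `γ₀KΩ` has the class of `γΩ`.

Only zeros matter, so no multiplier system of the theta constants is needed beyond the nonvanishing
of the inversion factors. -/

/-- The exponential `exp(iπ(ax² + 2bxy + dy²))`. -/
def gaussTerm (a b d x y : ℂ) : ℂ :=
  Complex.exp (Real.pi * Complex.I * (a * x ^ 2 + 2 * b * x * y + d * y ^ 2))

/-- The theta constant `∑ exp(iπ(am² + 2bmn + dn²))` of a binary quadratic form. -/
def binaryTheta (a b d : ℂ) : ℂ := ∑' n : ℤ × ℤ, gaussTerm a b d n.1 n.2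

theorem norm_gaussTerm (a b d : ℂ) (x y : ℝ) :
    ‖gaussTerm a b d x y‖ =
      Real.exp (-Real.pi * (a.im * x ^ 2 + 2 * b.im * x * y + d.im * y ^ 2)) := by
  have e : Real.pi * Complex.I * (a * (x : ℂ) ^ 2 + 2 * b * x * y + d * (y : ℂ) ^ 2) =
      ((Real.pi * x ^ 2 : ℝ) : ℂ) * a * Complex.I + ((2 * Real.pi * x * y : ℝ) : ℂ) * b * Complex.I
        + ((Real.pi * y ^ 2 : ℝ) : ℂ) * d * Complex.I := by
    push_cast; ring
  rw [gaussTerm, Complex.norm_exp, e]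
  simp only [Complex.add_re, Complex.mul_I_re, Complex.im_ofReal_mul]
  ring_nf

theorem summable_exp_neg_mul_int_sq {c : ℝ} (hc : 0 < c) :
    Summable fun n : ℤ => Real.exp (-Real.pi * (c * (n : ℝ) ^ 2)) := by
  have h := ((summable_jacobiTheta₂_term_iff 0 (c * Complex.I)).2 (by simpa using hc)).norm
  refine h.congr fun n => ?_
  rw [norm_jacobiTheta₂_term]
  simp
  ring

theorem summable_gaussTerm {a b d : ℂ} (ha : 0 < a.im) (hd : b.im ^ 2 < a.im * d.im) :
    Summable fun n : ℤ × ℤ => gaussTerm a b d n.1 n.2 := by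
  have hd0 : 0 < d.im := pos_of_mul_pos_right (lt_of_le_of_lt (sq_nonneg _) hd) ha.le
  have ht : 0 < a.im + d.im := add_pos ha hd0
  -- With `Y` the imaginary part, `det Y / tr Y` is a lower bound for its least eigenvalue, so the
  -- series is dominated by a product of two one-variable Gaussian series.
  have hc : 0 < (a.im * d.im - b.im ^ 2) / (a.im + d.im) := div_pos (sub_pos.2 hd) ht
  have hs := summable_exp_neg_mul_int_sq hc
  have hp := hs.mul_of_nonneg hs (fun _ => (Real.exp_pos _).le) (fun _ => (Real.exp_pos _).le)
  refine hp.of_norm_bounded fun n => ?_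
  have h := norm_gaussTerm a b d n.1 n.2
  push_cast at h
  rw [h, ← Real.exp_add, Real.exp_le_exp, ← mul_add]
  refine mul_le_mul_of_nonpos_left ?_ (by simpa using Real.pi_pos.le)
  rw [← mul_add, div_mul_eq_mul_div, div_le_iff₀ ht]
  -- By Cayley–Hamilton, `tr Y · ᵗvYv - det Y · |v|² = |Yv|²`, which is the sum of these two
  -- squares.
  nlinarith [sq_nonneg (a.im * n.1 + b.im * n.2), sq_nonneg (b.im * n.1 + d.im * n.2)]

theorem binaryTheta_swap (a b d : ℂ) : binaryTheta a b d = binaryTheta d b a := by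
  rw [binaryTheta, binaryTheta, ← (Equiv.prodComm ℤ ℤ).tsum_eq]
  refine tsum_congr fun n => ?_
  simp only [gaussTerm, Equiv.prodComm_apply, Prod.fst_swap, Prod.snd_swap]
  ring_nf

/-- Adding an integral symmetric matrix with even diagonal does not change the theta constant. -/
theorem binaryTheta_add_int (a b d : ℂ) (k l m : ℤ) :
    binaryTheta (a + 2 * k) (b + l) (d + 2 * m) = binaryTheta a b d := by
  refine tsum_congr fun n => ?_
  rw [gaussTerm, gaussTerm, Complex.exp_eq_exp_iff_exists_int]
  refine ⟨k * n.1 ^ 2 + l * n.1 * n.2 + m * n.2 ^ 2, ?_⟩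
  push_cast
  ring

/-- Inverting one variable stays in the Siegel half-space: the determinant of the imaginary part is
divided by `|a|²`. -/
theorem im_partial_inversion {a b d : ℂ} (ha : 0 < a.im) (hd : b.im ^ 2 < a.im * d.im) :
    0 < (-1 / a).im ∧ (b / a).im ^ 2 < (-1 / a).im * (d - b ^ 2 / a).im := by
  have hN : 0 < Complex.normSq a := Complex.normSq_pos.2 fun h => by simp [h] at ha
  have e1 : (-1 / a).im = a.im / Complex.normSq a := by simp [neg_div]
  have e2 : (b / a).im = (b.im * a.re - b.re * a.im) / Complex.normSq a := by
    rw [Complex.div_im]; ring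
  have e3 : (d - b ^ 2 / a).im = d.im -
      (2 * b.re * b.im * a.re - (b.re ^ 2 - b.im ^ 2) * a.im) / Complex.normSq a := by
    rw [Complex.sub_im, Complex.div_im, sq b, Complex.mul_re, Complex.mul_im]; ring
  refine ⟨e1 ▸ div_pos ha hN, ?_⟩
  rw [e1, e2, e3, ← sub_pos]
  have : a.im / Complex.normSq a * (d.im -
      (2 * b.re * b.im * a.re - (b.re ^ 2 - b.im ^ 2) * a.im) / Complex.normSq a) -
      ((b.im * a.re - b.re * a.im) / Complex.normSq a) ^ 2 =
      (a.im * d.im - b.im ^ 2) / Complex.normSq a := by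
    field_simp
    rw [Complex.normSq_apply]
    ring
  rw [this]
  exact div_pos (sub_pos.2 hd) hN

/-- For fixed `n` the sum over `m` is a one-variable Jacobi theta function at `z = bn`, `τ = a`. Its
functional equation is applied termwise in `n`, and the factor `exp(-πi(bn)²/a)` turns `d` into `d -
b²/a`. -/
theorem binaryTheta_partial_inversion {a b d : ℂ} (ha : 0 < a.im)
    (hd : b.im ^ 2 < a.im * d.im) :
    binaryTheta a b d =
      1 / (-Complex.I * a) ^ (1 / 2 : ℂ) * binaryTheta (-1 / a) (b / a) (d - b ^ 2 / a) := by
  have ha0 : a ≠ 0 := fun h => by simp [h] at ha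
  obtain ⟨h1, h2⟩ := im_partial_inversion ha hd
  have hs := summable_gaussTerm ha hd
  have hs' := summable_gaussTerm h1 h2
  have hsum : ∀ f : ℤ × ℤ → ℂ, Summable f → ∑' n, f n = ∑' n : ℤ, ∑' m : ℤ, f (m, n) :=
    fun f hf => by
      rw [← (Equiv.prodComm ℤ ℤ).tsum_eq f]
      exact ((Equiv.prodComm ℤ ℤ).summable_iff.2 hf).tsum_prod
  rw [binaryTheta, binaryTheta, hsum _ hs, hsum _ hs', ← tsum_mul_left]
  refine tsum_congr fun n => ?_
  have l : ∀ a b d : ℂ, ∑' m : ℤ, gaussTerm a b d m n =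
      Complex.exp (Real.pi * Complex.I * (d * n ^ 2)) * jacobiTheta₂ (b * n) a := fun a b d => by
    rw [jacobiTheta₂, ← tsum_mul_left]
    refine tsum_congr fun m => ?_
    rw [gaussTerm, jacobiTheta₂_term, ← Complex.exp_add]
    ring_nf
  have e : Real.pi * Complex.I * ((d - b ^ 2 / a) * (n : ℂ) ^ 2) =
      Real.pi * Complex.I * (d * (n : ℂ) ^ 2) + -Real.pi * Complex.I * (b * n) ^ 2 / a := by
    ring
  rw [l, l, jacobiTheta₂_functional_equation, e, Complex.exp_add, div_mul_eq_mul_div b a]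
  ring

theorem binaryTheta_partial_inversion_eq_zero_iff {a b d : ℂ} (ha : 0 < a.im)
    (hd : b.im ^ 2 < a.im * d.im) :
    binaryTheta a b d = 0 ↔ binaryTheta (-1 / a) (b / a) (d - b ^ 2 / a) = 0 := by
  have ha0 : a ≠ 0 := fun h => by simp [h] at ha
  rw [binaryTheta_partial_inversion ha hd, mul_eq_zero, or_iff_right]
  exact one_div_ne_zero fun h =>
    mul_ne_zero (neg_ne_zero.2 Complex.I_ne_zero) ha0 ((Complex.cpow_eq_zero_iff _ _).1 h).1

/-- The zero locus of the theta constant is stable under `Ω ↦ -Ω⁻¹`. -/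
theorem binaryTheta_inversion_eq_zero_iff {a b d : ℂ} (ha : 0 < a.im)
    (hd : b.im ^ 2 < a.im * d.im) :
    binaryTheta a b d = 0 ↔ binaryTheta (-d / (a * d - b ^ 2)) (b / (a * d - b ^ 2))
      (-a / (a * d - b ^ 2)) = 0 := by
  have ha0 : a ≠ 0 := fun h => by simp [h] at ha
  obtain ⟨h1, h2⟩ := im_partial_inversion ha hd
  have h3 : 0 < (d - b ^ 2 / a).im :=
    pos_of_mul_pos_right (lt_of_le_of_lt (sq_nonneg _) h2) h1.le
  have h0 : d - b ^ 2 / a ≠ 0 := fun h => by simp [h] at h3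
  have e : d - b ^ 2 / a = (a * d - b ^ 2) / a := by field_simp
  have h0' : a * d - b ^ 2 ≠ 0 := fun h => h0 (by rw [e, h, zero_div])
  -- A partial inversion in each variable in turn composes to the full inversion.
  rw [binaryTheta_partial_inversion_eq_zero_iff ha hd, binaryTheta_swap,
    binaryTheta_partial_inversion_eq_zero_iff h3 (by rwa [mul_comm]), binaryTheta_swap, e]
  have e1 : -1 / a - (b / a) ^ 2 / ((a * d - b ^ 2) / a) = -d / (a * d - b ^ 2) := by
    field_simp; ring
  have e2 : b / a / ((a * d - b ^ 2) / a) = b / (a * d - b ^ 2) := by field_simp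
  have e3 : -1 / ((a * d - b ^ 2) / a) = -a / (a * d - b ^ 2) := by field_simp
  rw [e1, e2, e3]

/-! ### The duplication formula -/

/-- The bijection `(ε, u, v) ↦ (u + v + ε, u - v)`. -/
def sumDiffEquiv : Fin 2 × ℤ × ℤ ≃ ℤ × ℤ where
  toFun x := (x.2.1 + x.2.2 + x.1, x.2.1 - x.2.2)
  invFun y := (if (y.1 + y.2) % 2 = 0 then 0 else 1, (y.1 + y.2) / 2, (y.1 + y.2) / 2 - y.2)
  left_inv := by
    rintro ⟨e, u, v⟩
    fin_cases e
    · simp only [Prod.mk.injEq]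
      refine ⟨if_pos ?_, ?_, ?_⟩ <;> simp <;> omega
    · simp only [Prod.mk.injEq]
      refine ⟨if_neg ?_, ?_, ?_⟩ <;> simp <;> omega
  right_inv := by
    rintro ⟨m, n⟩
    simp only [Prod.mk.injEq]
    split_ifs <;> simp <;> omega

/-- The theta constant with characteristic `((e/2, f/2), 0)` of a binary quadratic form. -/
def shiftedTheta (a b d : ℂ) (e f : Fin 2) : ℂ :=
  ∑' n : ℤ × ℤ, gaussTerm a b d (n.1 + (e : ℕ) / 2) (n.2 + (f : ℕ) / 2)

/-- Writing `n + e/2 = (2n + e)/2` exhibits this as a subseries of the series of the form divided by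
`4`. -/
theorem summable_shiftedTheta {a b d : ℂ} (ha : 0 < a.im) (hd : b.im ^ 2 < a.im * d.im)
    (e f : Fin 2) : Summable fun n : ℤ × ℤ =>
      gaussTerm a b d (n.1 + (e : ℕ) / 2) (n.2 + (f : ℕ) / 2) := by
  have h := summable_gaussTerm (a := a / 4) (b := b / 4) (d := d / 4) (by simpa using ha)
    (by simp only [Complex.div_ofNat_im]; nlinarith)
  have hi : Function.Injective fun n : ℤ × ℤ => (2 * n.1 + (e : ℕ), 2 * n.2 + (f : ℕ)) := by
    rintro ⟨m, n⟩ ⟨m', n'⟩ h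
    simp only [Prod.mk.injEq] at h ⊢
    omega
  refine (h.comp_injective hi).congr fun n => ?_
  simp only [Function.comp, gaussTerm]
  push_cast
  ring_nf

/-- The parallelogram law `Q(u + v) + Q(u - v) = 2Q(u) + 2Q(v)`, exponentiated. -/
theorem gaussTerm_mul_gaussTerm (a b d m m' n n' : ℂ) :
    gaussTerm (a / 2) (b / 2) (d / 2) (m + m') (n + n') *
      gaussTerm (a / 2) (b / 2) (d / 2) (m - m') (n - n') =
      gaussTerm a b d m n * gaussTerm a b d m' n' := by
  simp only [gaussTerm, ← Complex.exp_add]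
  ring_nf

/-- A pair of lattice vectors is `(μ + ν, μ - ν)` with `μ`, `ν` in a common coset of `ℤ²` in
`(½ℤ)²`. The four cosets, given by the parities of the sums of coordinates, are the four
characteristics. -/
theorem binaryTheta_half_sq {a b d : ℂ} (ha : 0 < a.im) (hd : b.im ^ 2 < a.im * d.im) :
    binaryTheta (a / 2) (b / 2) (d / 2) ^ 2 = ∑ e, ∑ f, shiftedTheta a b d e f ^ 2 := by
  have h := summable_gaussTerm (a := a / 2) (b := b / 2) (d := d / 2) (by simpa using ha)
    (by simp only [Complex.div_ofNat_im]; nlinarith)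
  have hs := summable_shiftedTheta ha hd
  -- `E` sends `((e, f), (u, u'), (v, v'))` to `((u + v + e, u' + v' + f), (u - v, u' - v'))`.
  let E : (Fin 2 × Fin 2) × (ℤ × ℤ) × (ℤ × ℤ) ≃ (ℤ × ℤ) × (ℤ × ℤ) :=
    ((Equiv.prodCongr (Equiv.refl _) (Equiv.prodProdProdComm ℤ ℤ ℤ ℤ)).trans
      ((Equiv.prodProdProdComm (Fin 2) (Fin 2) (ℤ × ℤ) (ℤ × ℤ)).trans
        (Equiv.prodCongr sumDiffEquiv sumDiffEquiv))).trans (Equiv.prodProdProdComm ℤ ℤ ℤ ℤ)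
  have hm := summable_mul_of_summable_norm h.norm h.norm
  have hE : ∀ x : (Fin 2 × Fin 2) × (ℤ × ℤ) × (ℤ × ℤ),
      gaussTerm (a / 2) (b / 2) (d / 2) (E x).1.1 (E x).1.2 *
        gaussTerm (a / 2) (b / 2) (d / 2) (E x).2.1 (E x).2.2 =
      gaussTerm a b d (x.2.1.1 + (x.1.1 : ℕ) / 2) (x.2.1.2 + (x.1.2 : ℕ) / 2) *
        gaussTerm a b d (x.2.2.1 + (x.1.1 : ℕ) / 2) (x.2.2.2 + (x.1.2 : ℕ) / 2) := by
    rintro ⟨⟨e, f⟩, ⟨u, u'⟩, v, v'⟩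
    refine Eq.trans ?_ (gaussTerm_mul_gaussTerm a b d _ _ _ _)
    simp only [E, sumDiffEquiv, Equiv.trans_apply, Equiv.prodCongr_apply, Prod.map,
      Equiv.prodProdProdComm_apply, Equiv.refl_apply, Equiv.coe_fn_mk]
    push_cast
    congr 2 <;> ring
  have hm' := (E.summable_iff.2 hm).congr hE
  rw [sq, binaryTheta, tsum_mul_tsum_of_summable_norm h.norm h.norm, ← E.tsum_eq,
    tsum_congr hE, hm'.tsum_prod, tsum_fintype, Fintype.sum_prod_type]
  refine Finset.sum_congr rfl fun e _ => Finset.sum_congr rfl fun f _ => ?_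
  rw [sq, shiftedTheta, tsum_mul_tsum_of_summable_norm (hs e f).norm (hs e f).norm]

/-! ### Theta constants of genus two as theta series of binary forms -/

theorem SiegelSpace.im_pos (Ω : SiegelSpace 2) :
    0 < (Ω.1 0 0).im ∧ (Ω.1 0 1).im ^ 2 < (Ω.1 0 0).im * (Ω.1 1 1).im := by
  have h1 := Ω.2.2.diag_pos (i := 0)
  have h2 := Ω.2.2.det_pos
  have h3 : Ω.1 1 0 = Ω.1 0 1 := Ω.2.1.apply 0 1
  rw [det_fin_two] at h2
  simp only [Matrix.map_apply, h3] at h1 h2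
  exact ⟨h1, by nlinarith⟩

theorem thetaConst_eq_shiftedTheta (k : Fin 16) (e f : Fin 2) (hk : k.1 = 4 * e.1 + 8 * f.1)
    (Ω : SiegelSpace 2) :
    thetaConst k Ω = shiftedTheta (Ω.1 0 0) (Ω.1 0 1) (Ω.1 1 1) e f := by
  have h3 : Ω.1 1 0 = Ω.1 0 1 := Ω.2.1.apply 0 1
  have h0 : k.1 % 2 = 0 := by omega
  have h1 : k.1 / 2 % 2 = 0 := by omega
  have h2 : k.1 / 4 % 2 = e.1 := by omega
  have h4 : k.1 / 8 % 2 = f.1 := by omega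
  rw [thetaConst, thetaFun, shiftedTheta, ← (finTwoArrowEquiv ℤ).tsum_eq]
  refine tsum_congr fun n => ?_
  have hn : finTwoArrowEquiv ℤ n = (n 0, n 1) := rfl
  simp only [hn, h0, h1, h2, h4, gaussTerm, dotProduct, mulVec, Fin.sum_univ_two, h3,
    Matrix.cons_val_zero, Matrix.cons_val_one, Pi.zero_apply]
  push_cast
  ring_nf

/-- `θ_0(Ω/2)`. -/
def halfTheta (Ω : SiegelSpace 2) : ℂ :=
  binaryTheta (Ω.1 0 0 / 2) (Ω.1 0 1 / 2) (Ω.1 1 1 / 2)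

theorem shiftedTheta_zero_zero (a b d : ℂ) : shiftedTheta a b d 0 0 = binaryTheta a b d := by
  simp [shiftedTheta, binaryTheta]

theorem thetaConst_zero_scale_half (r : ℝ) (hr : 0 < r) (hr' : 0 < r / 2) (Ω : SiegelSpace 2) :
    thetaConst 0 (Ω.scale (r / 2) hr') = halfTheta (Ω.scale r hr) := by
  rw [thetaConst_eq_shiftedTheta 0 0 0 rfl, shiftedTheta_zero_zero, halfTheta]
  simp only [SiegelSpace.scale, Matrix.smul_apply, smul_eq_mul]
  push_cast
  congr 1 <;> ring

theorem halfTheta_sq (Ω : SiegelSpace 2) :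
    halfTheta Ω ^ 2 = ∑ k ∈ ({0, 4, 8, 12} : Finset (Fin 16)), thetaConst k Ω ^ 2 := by
  obtain ⟨h1, h2⟩ := Ω.im_pos
  rw [halfTheta, binaryTheta_half_sq h1 h2, Finset.sum_insert (by decide),
    Finset.sum_insert (by decide), Finset.sum_insert (by decide), Finset.sum_singleton,
    thetaConst_eq_shiftedTheta 0 0 0 rfl, thetaConst_eq_shiftedTheta 4 1 0 rfl,
    thetaConst_eq_shiftedTheta 8 0 1 rfl, thetaConst_eq_shiftedTheta 12 1 1 rfl]
  simp only [Fin.sum_univ_two]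
  ring

/-- The factor is common to the four squares, so permuting them only rescales their sum. -/
theorem PreservesThetaSq.halfTheta_smul_eq_zero {γ : SiegelGroup 2}
    (h : PreservesThetaSq γ {0, 4, 8, 12}) {Ω : SiegelSpace 2} (hΩ : halfTheta Ω = 0) :
    halfTheta (γ • Ω) = 0 := by
  obtain ⟨c, σ, hσ, hc⟩ := h
  have hS : (({0, 4, 8, 12} : Finset (Fin 16)) : Set (Fin 16)) = {0, 4, 8, 12} := by simp
  rw [← hS] at hσ hc
  have e : halfTheta (γ • Ω) ^ 2 = c * (γ.denom Ω.1).det * halfTheta Ω ^ 2 := by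
    rw [halfTheta_sq, halfTheta_sq, Finset.mul_sum]
    exact Finset.sum_nbij σ hσ.mapsTo hσ.injOn hσ.surjOn fun k hk => hc k hk Ω
  rw [hΩ] at e
  exact pow_eq_zero_iff two_ne_zero |>.1 (by simpa using e)

/-! ### Unipotent elements and the inversion -/

namespace SiegelGroup

variable {g : ℕ}

/-- The translation `Ω ↦ Ω + T`. -/
def upper (T : Matrix (Fin g) (Fin g) ℤ) (hT : T.IsSymm) : SiegelGroup g :=
  ⟨fromBlocks 1 T 0 1, SymplecticGroup.fromBlocks_mem_iff.2 (by simp [hT.eq])⟩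

/-- The lower unipotent element with lower left block `S`. -/
def lower (S : Matrix (Fin g) (Fin g) ℤ) (hS : S.IsSymm) : SiegelGroup g :=
  ⟨fromBlocks 1 0 S 1, SymplecticGroup.fromBlocks_mem_iff.2 (by simp [hS.eq])⟩

/-- The inversion `Ω ↦ -Ω⁻¹`. -/
def inversion (g : ℕ) : SiegelGroup g :=
  ⟨fromBlocks 0 (-1) 1 0, SymplecticGroup.fromBlocks_mem_iff.2 (by simp)⟩

theorem upper_smul (T : Matrix (Fin g) (Fin g) ℤ) (hT : T.IsSymm) (Ω : SiegelSpace g) :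
    (upper T hT • Ω).1 = Ω.1 + toC T := by
  simp [smul_coe, num, denom, upper, A, B, C, D]

theorem inversion_smul (Ω : SiegelSpace g) : (inversion g • Ω).1 = -Ω.1⁻¹ := by
  have : (toC (-1 : Matrix (Fin g) (Fin g) ℤ)) = -1 := by
    rw [← zero_sub, toC_sub, toC_one]; simp
  simp [smul_coe, num, denom, inversion, A, B, C, D, this]

theorem inversion_mul_lower (S : Matrix (Fin g) (Fin g) ℤ) (hS : S.IsSymm) :
    inversion g * lower S hS = upper (-S) hS.neg * inversion g := by
  refine Subtype.ext ?_
  change fromBlocks 0 (-1) 1 0 * fromBlocks 1 0 S 1 = fromBlocks 1 (-S) 0 1 * fromBlocks 0 (-1) 1 0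
  simp [fromBlocks_multiply]

theorem halfTheta_upper_smul (T : Matrix (Fin 2) (Fin 2) ℤ) (hT : ((4 : ℤ) • T).IsSymm)
    (Ω : SiegelSpace 2) : halfTheta (upper ((4 : ℤ) • T) hT • Ω) = halfTheta Ω := by
  simp only [halfTheta, upper_smul]
  -- Half of `4T` is `2T`, which is integral with even diagonal.
  rw [← binaryTheta_add_int (Ω.1 0 0 / 2) _ _ (T 0 0) (2 * T 0 1) (T 1 1)]
  simp only [Matrix.add_apply, Matrix.map_apply, Matrix.smul_apply, smul_eq_mul]
  push_cast
  congr 1 <;> ring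

/-- Uses `-(Ω/2)⁻¹ = 2(-Ω⁻¹)`. -/
theorem halfTheta_eq_zero_iff_inversion (Ω : SiegelSpace 2) :
    halfTheta Ω = 0 ↔ binaryTheta (2 * (inversion 2 • Ω).1 0 0) (2 * (inversion 2 • Ω).1 0 1)
      (2 * (inversion 2 • Ω).1 1 1) = 0 := by
  obtain ⟨h1, h2⟩ := Ω.im_pos
  have h3 : Ω.1 1 0 = Ω.1 0 1 := Ω.2.1.apply 0 1
  have hd : Ω.1.det = Ω.1 0 0 * Ω.1 1 1 - Ω.1 0 1 ^ 2 := by rw [det_fin_two, h3]; ring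
  rw [halfTheta, binaryTheta_inversion_eq_zero_iff (by simpa using h1)
    (by simp only [Complex.div_ofNat_im]; nlinarith)]
  have e : Ω.1 0 0 / 2 * (Ω.1 1 1 / 2) - (Ω.1 0 1 / 2) ^ 2 = Ω.1.det / 4 := by rw [hd]; ring
  simp only [inversion_smul, inv_def, adjugate_fin_two, Ring.inverse_eq_inv', Matrix.neg_apply,
    Matrix.smul_apply, smul_eq_mul, Matrix.of_apply, Matrix.cons_val', Matrix.cons_val_zero,
    Matrix.cons_val_one, e]
  refine iff_of_eq (congrArg (· = 0) ?_)
  congr 1 <;> · simp; ring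

/-- After inversion the lower unipotent becomes the translation by `-S`, and the doubled argument
moves by `-2S`, whose diagonal is even. No divisibility of `S` is needed. -/
theorem halfTheta_lower_smul_eq_zero_iff (S : Matrix (Fin 2) (Fin 2) ℤ) (hS : S.IsSymm)
    (Ω : SiegelSpace 2) : halfTheta (lower S hS • Ω) = 0 ↔ halfTheta Ω = 0 := by
  rw [halfTheta_eq_zero_iff_inversion, halfTheta_eq_zero_iff_inversion, ← mul_smul,
    inversion_mul_lower, mul_smul, upper_smul]
  rw [← binaryTheta_add_int (2 * (inversion 2 • Ω).1 0 0) _ _ (-S 0 0) (2 * -S 0 1) (-S 1 1)]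
  simp only [Matrix.add_apply, Matrix.map_apply, Matrix.neg_apply]
  push_cast
  refine iff_of_eq (congrArg (· = 0) ?_)
  congr 1 <;> ring

end SiegelGroup

namespace SiegelGroup
variable {g : ℕ}

/-! ### Normality of `Γ(2,4)` -/

theorem rel_transpose (γ : SiegelGroup g) :
    γ.A * γ.Bᵀ = γ.B * γ.Aᵀ ∧ γ.C * γ.Dᵀ = γ.D * γ.Cᵀ ∧ γ.A * γ.Dᵀ - γ.B * γ.Cᵀ = 1 ∧
      γ.D * γ.Aᵀ - γ.C * γ.Bᵀ = 1 := by
  obtain ⟨h1, h2, h3⟩ := γ⁻¹.rel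
  obtain ⟨hA, hB, hC, hD⟩ := inv_blocks γ
  rw [hA, hC] at h1
  rw [hB, hD] at h2
  rw [hA, hB, hC, hD] at h3
  simp only [transpose_neg, transpose_transpose, Matrix.neg_mul, Matrix.mul_neg, neg_inj,
    neg_neg] at h1 h2 h3
  exact ⟨h2.symm, h1.symm, by simpa [transpose_sub, transpose_mul] using congrArg transpose h3, h3⟩

/-- Modulo `2`, symmetric matrices with zero diagonal are stable under `X ↦ PXPᵀ`, and the cross
terms form `-(Y + Yᵀ)` with `Y = PaQᵀ`, whose diagonal is even. -/
theorem diag_conj_eq_zero (P Q a b c d : Matrix (Fin 2) (Fin 2) (ZMod 2)) (hb : bᵀ = b)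
    (hc : cᵀ = c) (hd : d = -aᵀ) (hb0 : ∀ i, b i i = 0) (hc0 : ∀ i, c i i = 0) (i : Fin 2) :
    ((P * a + Q * c) * (-Qᵀ) + (P * b + Q * d) * Pᵀ) i i = 0 := by
  have h2 : (2 : ZMod 2) = 0 := rfl
  have hb1 : b 1 0 = b 0 1 := congrFun (congrFun hb 0) 1
  have hc1 : c 1 0 = c 0 1 := congrFun (congrFun hc 0) 1
  subst hd
  simp only [Matrix.add_apply, Matrix.mul_apply, Fin.sum_univ_two, Matrix.neg_apply,
    transpose_apply, hb1, hc1, hb0, hc0]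
  linear_combination (-(P i 0 * a 0 0 * Q i 0) - P i 0 * a 0 1 * Q i 1 - P i 1 * a 1 0 * Q i 0
    - P i 1 * a 1 1 * Q i 1 - Q i 0 * Q i 1 * c 0 1 + P i 0 * P i 1 * b 0 1) * h2

theorem mem_Gamma24_iff {h : SiegelGroup 2} : h ∈ Gamma24 2 ↔
    ∃ a b c d : Matrix (Fin 2) (Fin 2) ℤ, h.A = 1 + (2 : ℤ) • a ∧ h.B = (2 : ℤ) • b ∧
      h.C = (2 : ℤ) • c ∧ h.D = 1 + (2 : ℤ) • d ∧ (∀ i, (2 : ℤ) ∣ b i i) ∧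
      ∀ i, (2 : ℤ) ∣ c i i := by
  constructor
  · rintro ⟨ha, hb, hc, hd, hb', hc'⟩
    choose a ha using ha
    choose b hb using hb
    choose c hc using hc
    choose d hd using hd
    refine ⟨of a, of b, of c, of d, ?_, ?_, ?_, ?_, fun i => ?_, fun i => ?_⟩
    · rw [← sub_eq_iff_eq_add']; ext i j; simpa using ha i j
    · ext i j; simpa using hb i j
    · ext i j; simpa using hc i j
    · rw [← sub_eq_iff_eq_add']; ext i j; simpa using hd i j
    · have := hb' i; rw [hb] at this; simp only [of_apply]; omega
    · have := hc' i; rw [hc] at this; simp only [of_apply]; omega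
  · rintro ⟨a, b, c, d, ha, hb, hc, hd, hb', hc'⟩
    refine ⟨fun i j => ?_, fun i j => ?_, fun i j => ?_, fun i j => ?_, fun i => ?_, fun i => ?_⟩
    · rw [ha, add_sub_cancel_left]; exact dvd_mul_right _ _
    · rw [hb]; exact dvd_mul_right _ _
    · rw [hc]; exact dvd_mul_right _ _
    · rw [hd, add_sub_cancel_left]; exact dvd_mul_right _ _
    · have := hb' i; rw [hb, Matrix.smul_apply, smul_eq_mul]; omega
    · have := hc' i; rw [hc, Matrix.smul_apply, smul_eq_mul]; omega

/-- Reduction of integral matrices modulo `n`. -/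
abbrev toZMod (n : ℕ) : Matrix (Fin g) (Fin g) ℤ →+* Matrix (Fin g) (Fin g) (ZMod n) :=
  (Int.castRingHom (ZMod n)).mapMatrix

theorem toZMod_transpose (n : ℕ) (M : Matrix (Fin g) (Fin g) ℤ) :
    toZMod n Mᵀ = (toZMod n M)ᵀ := rfl

theorem toZMod_two_smul (M : Matrix (Fin g) (Fin g) ℤ) : toZMod 2 ((2 : ℤ) • M) = 0 := by
  ext i j
  simp only [RingHom.mapMatrix_apply, Matrix.map_apply, Matrix.smul_apply, smul_eq_mul, map_mul]
  exact zero_mul _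

theorem toZMod_apply_eq_zero_iff (n : ℕ) (M : Matrix (Fin g) (Fin g) ℤ) (i j : Fin g) :
    toZMod n M i j = 0 ↔ (n : ℤ) ∣ M i j := by
  simpa using ZMod.intCast_zmod_eq_zero_iff_dvd (M i j) n

instance Gamma24_normal : (Gamma24 2).Normal where
  conj_mem h hh γ := by
    obtain ⟨a, b, c, d, ha, hb, hc, hd, hb', hc'⟩ := mem_Gamma24_iff.1 hh
    obtain ⟨r1, r2, r3⟩ := h.rel
    obtain ⟨s1, s2, s3, s4⟩ := γ.rel_transpose
    obtain ⟨hA, hB, hC, hD⟩ := inv_blocks γ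
    obtain ⟨mA, mB, mC, mD⟩ := mul_blocks γ h
    obtain ⟨nA, nB, nC, nD⟩ := mul_blocks (γ * h) γ⁻¹
    rw [ha, hc] at r1
    rw [hb, hd] at r2
    rw [ha, hb, hc, hd] at r3
    have h2 : Function.Injective fun M : Matrix (Fin 2) (Fin 2) ℤ => (2 : ℤ) • M :=
      smul_right_injective _ two_ne_zero
    -- Writing `h = 1 + 2X`, the symplectic relations of `h` divided by `2` say that `X` modulo `2`
    -- lies in the symplectic Lie algebra. Conjugation replaces `X` by `γXγ⁻¹`.
    have qc : cᵀ = c + (2 : ℤ) • (aᵀ * c - cᵀ * a) := by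
      refine h2 ?_
      simp only [transpose_add, transpose_smul, transpose_one] at r1
      have := sub_eq_zero.2 r1
      rw [← sub_eq_zero, ← neg_zero, ← this]
      noncomm_ring
    have qb : bᵀ = b + (2 : ℤ) • (dᵀ * b - bᵀ * d) := by
      refine h2 ?_
      simp only [transpose_add, transpose_smul, transpose_one] at r2
      have := sub_eq_zero.2 r2
      rw [← sub_eq_zero, ← this]
      noncomm_ring
    have qd : d = -aᵀ + (2 : ℤ) • (cᵀ * b - aᵀ * d) := by
      refine h2 ?_
      simp only [transpose_add, transpose_smul, transpose_one] at r3
      have := sub_eq_zero.2 r3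
      rw [← sub_eq_zero, ← this]
      noncomm_ring
    replace qc := congrArg (toZMod 2) qc
    replace qb := congrArg (toZMod 2) qb
    replace qd := congrArg (toZMod 2) qd
    rw [map_add, toZMod_two_smul, add_zero, toZMod_transpose] at qb qc
    rw [map_add, toZMod_two_smul, add_zero, map_neg, toZMod_transpose] at qd
    -- Taking `(P, Q) = (A, B)` treats the upper right block, and `(C, D)` the lower left one up to
    -- sign.
    have key := fun P Q : Matrix (Fin 2) (Fin 2) ℤ =>
      diag_conj_eq_zero (toZMod 2 P) (toZMod 2 Q) _ _ _ _ qb qc qd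
        (fun i => (toZMod_apply_eq_zero_iff 2 b i i).2 (hb' i))
        (fun i => (toZMod_apply_eq_zero_iff 2 c i i).2 (hc' i))
    replace key : ∀ (P Q : Matrix (Fin 2) (Fin 2) ℤ) (i : Fin 2),
        (2 : ℤ) ∣ ((P * a + Q * c) * (-Qᵀ) + (P * b + Q * d) * Pᵀ) i i := fun P Q i => by
      refine (toZMod_apply_eq_zero_iff 2 _ i i).1 ?_
      rw [← key P Q i]
      simp only [map_add, map_mul, map_neg, toZMod_transpose]
    refine mem_Gamma24_iff.2 ⟨(γ.A * a + γ.B * c) * γ.Dᵀ + (γ.A * b + γ.B * d) * (-γ.Cᵀ),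
      (γ.A * a + γ.B * c) * (-γ.Bᵀ) + (γ.A * b + γ.B * d) * γ.Aᵀ,
      -((γ.C * a + γ.D * c) * (-γ.Dᵀ) + (γ.C * b + γ.D * d) * γ.Cᵀ),
      (γ.C * a + γ.D * c) * (-γ.Bᵀ) + (γ.C * b + γ.D * d) * γ.Aᵀ, ?_, ?_, ?_, ?_,
      key _ _, fun i => by simpa only [Matrix.neg_apply, dvd_neg] using key γ.C γ.D i⟩
    · rw [nA, mA, mB, hA, hC, ha, hb, hc, hd, ← sub_eq_zero, ← sub_eq_zero.2 s3]
      noncomm_ring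
    · rw [nB, mA, mB, hB, hD, ha, hb, hc, hd, ← sub_eq_zero, ← sub_eq_zero.2 s1.symm]
      noncomm_ring
    · rw [nC, mC, mD, hA, hC, ha, hb, hc, hd, ← sub_eq_zero, ← sub_eq_zero.2 s2]
      noncomm_ring
    · rw [nD, mC, mD, hB, hD, ha, hb, hc, hd, ← sub_eq_zero, ← sub_eq_zero.2 s4]
      noncomm_ring

/-! ### Making the upper right block divisible by `p` -/

/-- If `det(D + SB)` vanished for all symmetric `S`, five choices of `S` and the symmetry relation
would kill all six `2 × 2` minors of `B` stacked on `D`. By Cauchy–Binet, `det(AᵀD - CᵀB) = 1` is a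
combination of these minors. -/
theorem exists_symm_isUnit_det {F : Type*} [Field F] (h2 : (2 : F) ≠ 0)
    {A B C D : Matrix (Fin 2) (Fin 2) F} (h : Bᵀ * D = Dᵀ * B) (h1 : Aᵀ * D - Cᵀ * B = 1) :
    ∃ S : Matrix (Fin 2) (Fin 2) F, S.IsSymm ∧ IsUnit (D + S * B).det := by
  by_contra! hS
  replace hS : ∀ x y z : F, (D + !![x, y; y, z] * B).det = 0 := fun x y z => by
    by_contra hne
    exact hS _ (by ext i j; fin_cases i <;> fin_cases j <;> rfl) (isUnit_iff_ne_zero.2 hne)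
  have e0 := hS 0 0 0
  have e1 := hS 1 0 0
  have e2 := hS 0 0 1
  have e3 := hS 1 0 1
  have e4 := hS 0 1 0
  have hBD := congrFun (congrFun h 0) 1
  simp only [det_fin_two, Matrix.add_apply, Matrix.mul_apply, Fin.sum_univ_two, of_apply,
    cons_val', cons_val_zero, cons_val_one, cons_val_fin_one, transpose_apply] at e0 e1 e2 e3 e4 hBD
  have p0 : D 0 0 * D 1 1 - D 0 1 * D 1 0 = 0 := by linear_combination e0
  have p1 : B 0 0 * D 1 1 - B 0 1 * D 1 0 = 0 := by linear_combination e1 - e0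
  have p2 : D 0 0 * B 1 1 - D 0 1 * B 1 0 = 0 := by linear_combination e2 - e0
  have p3 : B 0 0 * B 1 1 - B 0 1 * B 1 0 = 0 := by linear_combination e3 - e1 - e2 + e0
  -- The off-diagonal entry of `S` sees only the difference of the last two minors, while the
  -- symmetry relation says that their sum is zero. Separating them requires dividing by `2`.
  have p4 : D 0 0 * B 0 1 - D 0 1 * B 0 0 = 0 := by
    refine (mul_eq_zero.1 (?_ : (2 : F) * _ = 0)).resolve_left h2
    linear_combination e4 - e0 + p3 - hBD
  have p5 : D 1 0 * B 1 1 - D 1 1 * B 1 0 = 0 := by linear_combination -p4 - hBD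
  have hdet := congrArg det h1
  rw [det_one, det_fin_two] at hdet
  simp only [Matrix.sub_apply, Matrix.mul_apply, Fin.sum_univ_two, transpose_apply] at hdet
  refine one_ne_zero (α := F) ?_
  rw [← hdet]
  linear_combination (A 0 0 * A 1 1 - A 0 1 * A 1 0) * p0 + (C 0 0 * C 1 1 - C 0 1 * C 1 0) * p3
    - (A 0 0 * C 0 1 - A 0 1 * C 0 0) * p4 - (A 0 0 * C 1 1 - A 0 1 * C 1 0) * p2
    + (A 1 0 * C 0 1 - A 1 1 * C 0 0) * p1 - (A 1 0 * C 1 1 - A 1 1 * C 1 0) * p5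

theorem exists_symm_add_mul_eq_zero {F : Type*} [Field F] (h2 : (2 : F) ≠ 0)
    {A B C D : Matrix (Fin 2) (Fin 2) F} (h : Bᵀ * D = Dᵀ * B) (h1 : Aᵀ * D - Cᵀ * B = 1) :
    ∃ S T : Matrix (Fin 2) (Fin 2) F, S.IsSymm ∧ T.IsSymm ∧ B + T * (D + S * B) = 0 := by
  obtain ⟨S, hS, hu⟩ := exists_symm_isUnit_det h2 h h1
  set V := D + S * B with hV
  have hs : Vᵀ * B = Bᵀ * V := by
    rw [hV, transpose_add, transpose_mul, hS.eq, Matrix.add_mul, Matrix.mul_add, h,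
      Matrix.mul_assoc]
  have hut : IsUnit (Vᵀ).det := by rwa [det_transpose]
  -- `BV⁻¹` is symmetric because `VᵀB = BᵀV`.
  refine ⟨S, -(B * V⁻¹), hS, ?_, ?_⟩
  · rw [Matrix.IsSymm, transpose_neg, transpose_mul, transpose_nonsing_inv]
    congr 1
    calc (Vᵀ)⁻¹ * Bᵀ = (Vᵀ)⁻¹ * (Bᵀ * V) * V⁻¹ := by
          rw [← Matrix.mul_assoc, Matrix.mul_assoc _ V, mul_nonsing_inv _ hu, Matrix.mul_one]
      _ = B * V⁻¹ := by rw [← hs, ← Matrix.mul_assoc, nonsing_inv_mul _ hut, Matrix.one_mul]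
  · rw [Matrix.neg_mul, Matrix.mul_assoc, nonsing_inv_mul _ hu, Matrix.mul_one, add_neg_cancel]

/-- Used with `m = 4`: lifting `m⁻¹S` and multiplying by `m` gives a lift of `S` divisible by `m`.
-/
theorem exists_symm_lift {p : ℕ} [Fact p.Prime] {m : ℤ} (hm : (m : ZMod p) ≠ 0)
    {S : Matrix (Fin g) (Fin g) (ZMod p)} (hS : S.IsSymm) :
    ∃ M : Matrix (Fin g) (Fin g) ℤ, (m • M).IsSymm ∧ toZMod p (m • M) = S := by
  refine ⟨S.map fun x => ((m : ZMod p)⁻¹ * x).cast, ?_, ?_⟩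
  · ext i j
    simp only [transpose_apply, Matrix.smul_apply, Matrix.map_apply, hS.apply i j]
  · ext i j
    simp only [RingHom.mapMatrix_apply, Matrix.map_apply, Matrix.smul_apply, smul_eq_mul,
      Int.coe_castRingHom, Int.cast_mul, ZMod.intCast_cast, ZMod.cast_id', id, mul_inv_cancel_left₀ hm]

theorem exists_unipotent_mul_dvd {p : ℕ} (hp : p.Prime) (hp2 : 2 < p) (h : SiegelGroup 2) :
    ∃ (S T : Matrix (Fin 2) (Fin 2) ℤ) (hS : ((4 : ℤ) • S).IsSymm) (hT : ((4 : ℤ) • T).IsSymm),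
      ∀ i j, (p : ℤ) ∣ (upper ((4 : ℤ) • T) hT * (lower ((4 : ℤ) • S) hS * h)).B i j := by
  have := Fact.mk hp
  obtain ⟨-, r2, r3⟩ := h.rel
  have h2 : (2 : ZMod p) ≠ 0 := by
    intro h0
    have := (ZMod.natCast_eq_zero_iff 2 p).1 (by exact_mod_cast h0)
    exact absurd (Nat.le_of_dvd two_pos this) (by omega)
  have h4 : ((4 : ℤ) : ZMod p) ≠ 0 := by
    have : ((4 : ℤ) : ZMod p) = 2 * 2 := by push_cast; norm_num
    rw [this]; exact mul_ne_zero h2 h2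
  obtain ⟨S', T', hS', hT', e⟩ := exists_symm_add_mul_eq_zero h2
    (A := toZMod p h.A) (B := toZMod p h.B) (C := toZMod p h.C) (D := toZMod p h.D)
    (by simpa only [map_mul, toZMod_transpose] using congrArg (toZMod p) r2)
    (by simpa only [map_mul, map_sub, map_one, toZMod_transpose] using congrArg (toZMod p) r3)
  obtain ⟨S, hS, rfl⟩ := exists_symm_lift h4 hS'
  obtain ⟨T, hT, rfl⟩ := exists_symm_lift h4 hT'
  refine ⟨S, T, hS, hT, fun i j => (toZMod_apply_eq_zero_iff p _ i j).1 ?_⟩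
  have eB : (upper ((4 : ℤ) • T) hT * (lower ((4 : ℤ) • S) hS * h)).B =
      h.B + (4 : ℤ) • T * (h.D + (4 : ℤ) • S * h.B) := by
    obtain ⟨-, b1, -, -⟩ := mul_blocks (upper ((4 : ℤ) • T) hT) (lower ((4 : ℤ) • S) hS * h)
    obtain ⟨-, b2, -, d2⟩ := mul_blocks (lower ((4 : ℤ) • S) hS) h
    rw [b1, b2, d2]
    simp [upper, lower, A, B, C, D, add_comm]
  rw [eB, map_add, map_mul, map_add, map_mul, e, Matrix.zero_apply]

theorem upper_mem_Gamma24 (T : Matrix (Fin g) (Fin g) ℤ) (hT : ((4 : ℤ) • T).IsSymm) :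
    upper ((4 : ℤ) • T) hT ∈ Gamma24 g := by
  refine ⟨?_, ?_, ?_, ?_, ?_, ?_⟩ <;> intros <;>
    simp only [upper, A, B, C, D, toBlocks_fromBlocks₁₁, toBlocks_fromBlocks₁₂,
      toBlocks_fromBlocks₂₁, toBlocks_fromBlocks₂₂, sub_self, Matrix.zero_apply, dvd_zero,
      Matrix.smul_apply, smul_eq_mul, dvd_mul_right]
  exact dvd_mul_of_dvd_left (by norm_num) _

theorem lower_mem_Gamma24 (S : Matrix (Fin g) (Fin g) ℤ) (hS : ((4 : ℤ) • S).IsSymm) :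
    lower ((4 : ℤ) • S) hS ∈ Gamma24 g := by
  refine ⟨?_, ?_, ?_, ?_, ?_, ?_⟩ <;> intros <;>
    simp only [lower, A, B, C, D, toBlocks_fromBlocks₁₁, toBlocks_fromBlocks₁₂,
      toBlocks_fromBlocks₂₁, toBlocks_fromBlocks₂₂, sub_self, Matrix.zero_apply, dvd_zero,
      Matrix.smul_apply, smul_eq_mul, dvd_mul_right]
  exact dvd_mul_of_dvd_left (by norm_num) _

/-! ### The action on multiples of period matrices -/

/-- Stated for blocks rather than for `conjP`, so that it serves both `γ₀ ↦ (γ₀)_p` and the reverse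
passage from `h` to `N` with `N_p = h`. -/
theorem smul_scale {p : ℕ} (hp : 0 < (p : ℝ)) {γ δ : SiegelGroup g} (hA : δ.A = γ.A)
    (hB : δ.B = (p : ℤ) • γ.B) (hC : γ.C = (p : ℤ) • δ.C) (hD : δ.D = γ.D) (Ω : SiegelSpace g) :
    δ • Ω.scale p hp = (γ • Ω).scale p hp := by
  have hs : ∀ M : Matrix (Fin g) (Fin g) ℤ, toC ((p : ℤ) • M) = (p : ℂ) • toC M := fun M => by
    ext i j; simp only [Matrix.map_apply, Matrix.smul_apply, smul_eq_mul]; push_cast; rfl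
  refine Subtype.ext ?_
  change (toC δ.A * (((p : ℝ) : ℂ) • Ω.1) + toC δ.B) *
      (toC δ.C * (((p : ℝ) : ℂ) • Ω.1) + toC δ.D)⁻¹ =
    ((p : ℝ) : ℂ) • ((toC γ.A * Ω.1 + toC γ.B) * (toC γ.C * Ω.1 + toC γ.D)⁻¹)
  rw [hA, hB, hC, hD, hs, hs]
  simp only [Complex.ofReal_natCast, Matrix.mul_smul, Matrix.smul_mul, ← smul_add]

theorem conjP_smul_scale {p : ℕ} (hp : p ≠ 0) (hp' : 0 < (p : ℝ)) (γ : Gamma0 g p)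
    (Ω : SiegelSpace g) : conjP p hp γ • Ω.scale p hp' = (γ.1 • Ω).scale p hp' := by
  refine smul_scale (γ := γ.1) (δ := conjP p hp γ) hp' rfl rfl ?_ rfl Ω
  ext i j
  exact (Int.mul_ediv_cancel' (γ.2 i j)).symm

/-- An element of `Γ(2,4)` with upper right block divisible by the odd number `p` is of the form
`N_p` with `N ∈ Γ(2,4)`. -/
theorem exists_smul_scale_eq {p : ℕ} (hp : 0 < (p : ℝ)) (hodd : Odd p) {h : SiegelGroup g}
    (hh : h ∈ Gamma24 g) (hB : ∀ i j, (p : ℤ) ∣ h.B i j) :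
    ∃ N ∈ Gamma24 g, ∀ Ω : SiegelSpace g, h • Ω.scale p hp = (N • Ω).scale p hp := by
  choose b hb using hB
  have hb' : h.B = (p : ℤ) • of b := by ext i j; simpa using hb i j
  obtain ⟨r1, r2, r3⟩ := h.rel
  have hp0 : (p : ℤ) ≠ 0 := by exact_mod_cast hp.ne'
  let N : SiegelGroup g := ⟨fromBlocks h.A (of b) ((p : ℤ) • h.C) h.D, by
    refine SymplecticGroup.fromBlocks_mem_iff.2 ⟨?_, ?_, ?_⟩
    · rw [transpose_smul, Matrix.mul_smul, Matrix.smul_mul, r1]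
    · refine smul_right_injective _ hp0 ?_
      simp only
      rw [← Matrix.mul_smul (h.D)ᵀ, ← Matrix.smul_mul, ← transpose_smul, ← hb', r2]
    · rw [transpose_smul, Matrix.smul_mul, ← Matrix.mul_smul, ← hb', r3]⟩
  -- Since `p` is odd, dividing the upper right block by `p` keeps its divisibility by `2` and, on
  -- the diagonal, by `4`.
  have c2 : IsCoprime (2 : ℤ) p := by
    exact_mod_cast Nat.isCoprime_iff_coprime.2 (Nat.coprime_two_left.2 hodd)
  have c4 : IsCoprime (4 : ℤ) p := by
    rw [show (4 : ℤ) = 2 ^ 2 by norm_num]; exact c2.pow_left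
  obtain ⟨ma, mb, mc, md, mb', mc'⟩ := hh
  refine ⟨N, ⟨ma, fun i j => c2.dvd_of_dvd_mul_left (hb i j ▸ mb i j),
    fun i j => (mc i j).mul_left _, md, fun i => c4.dvd_of_dvd_mul_left (hb i i ▸ mb' i),
    fun i => (mc' i).mul_left _⟩, smul_scale hp rfl hb' rfl rfl⟩

end SiegelGroup

end

/-! ### Stability of the locus -/

open SiegelGroup in
theorem mainTheorem9 (p : ℕ) (hp : p.Prime) (hp2 : 2 < p)
    (γ γ' : SiegelGroup 2) (γ₀ : SiegelGroup.Gamma0 2 p)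
    (hγ₀ : (γ₀.1 : SiegelGroup 2 ⧸ SiegelGroup.Gamma24 2) = γ)
    (hγ' : (SiegelGroup.conjP p hp.ne_zero γ₀ : SiegelGroup 2 ⧸ SiegelGroup.Gamma24 2) = γ')
    (hS : PreservesThetaSq γ' {0, 4, 8, 12})
    (Ω : SiegelSpace 2) (hΩ : Moduli24.mk Ω ∈ locusL' p hp.pos) :
    Moduli24.mk (γ • Ω) ∈ locusL' p hp.pos := by
  have hp' : 0 < (p : ℝ) := by exact_mod_cast hp.pos
  obtain ⟨Ω₁, hΩ₁, M, hM, h0⟩ := hΩ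
  obtain ⟨⟨M₁, hM₁⟩, rfl⟩ := Quotient.exact hΩ₁
  change thetaConst 0 ((M • M₁ • Ω).scale _ _) = 0 at h0
  rw [thetaConst_zero_scale_half p hp', ← mul_smul] at h0
  set K := M * M₁ with hK
  have hKm : K ∈ Gamma24 2 := mul_mem hM hM₁
  have hn : (Gamma24 2).Normal := inferInstance
  have m₀ : γ₀.1⁻¹ * γ ∈ Gamma24 2 := QuotientGroup.eq.1 hγ₀
  have m' : (conjP p hp.ne_zero γ₀)⁻¹ * γ' ∈ Gamma24 2 := QuotientGroup.eq.1 hγ'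
  set P := conjP p hp.ne_zero γ₀ with hP
  -- the element of `Γ(2,4)` relating `γ'(pKΩ)` and `p(γ₀KΩ)`
  have m'' : γ' * P⁻¹ ∈ Gamma24 2 := hn.mem_comm m'
  have h1 := hS.halfTheta_smul_eq_zero h0
  rw [show γ' = γ' * P⁻¹ * P by group, mul_smul, hP, conjP_smul_scale, ← hP] at h1
  obtain ⟨S, T, hSs, hTs, hdvd⟩ := exists_unipotent_mul_dvd hp hp2 (γ' * P⁻¹)
  rw [← halfTheta_lower_smul_eq_zero_iff _ hSs, ← halfTheta_upper_smul T hTs, ← mul_smul,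
    ← mul_smul] at h1
  obtain ⟨N, hN, hNs⟩ := exists_smul_scale_eq hp' (hp.odd_of_ne_two hp2.ne') (mul_mem
    (upper_mem_Gamma24 T hTs) (mul_mem (lower_mem_Gamma24 S hSs) m'')) hdvd
  rw [mul_assoc, hNs, ← thetaConst_zero_scale_half p hp' (by positivity)] at h1
  -- This makes `γ₀KΩ` and `γΩ` equivalent under `Γ(2,4)`, so `γ₀KΩ` can represent the class of
  -- `γΩ`.
  have hL : γ₀.1 * K * γ⁻¹ ∈ Gamma24 2 := by
    have : γ₀.1 * K * γ⁻¹ = γ₀.1 * (K * (γ₀.1⁻¹ * γ)⁻¹) * γ₀.1⁻¹ := by group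
    rw [this]
    exact hn.conj_mem _ (mul_mem hKm (inv_mem m₀)) _
  refine ⟨γ₀.1 • K • Ω, Quotient.sound ⟨⟨_, hL⟩, ?_⟩, N, hN, h1⟩
  change (γ₀.1 * K * γ⁻¹) • γ • Ω = _
  simp only [← mul_smul, mul_assoc, inv_mul_cancel, mul_one]
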